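/- For an integer $n\ge 2$ let $\mathcal M_n:[0,\infty)\to\mathbb R$ be the solution of $\mathcal M_n'(x)=1-\mathcal M_n(x)^{2/n}$ for $x\ge 0$, $\mathcal M_n(0)=0$ (one-sided derivative at $0$); such a solution exists and is unique. For $\alpha\in(0,1]$ put $$\gamma_\alpha=\frac1\alpha\exp\Bigl(-\int_0^1\frac{1-x^{(1-\alpha)/\alpha}}{1-x}\,dx\Bigr),$$ and define $\sigma_k=\sigma_k(\alpha)$ by $\sigma_1=1$ and $$\sigma_k=\frac1{k(k-1)}\sum_{\nu=1}^{k-1}\sigma_\nu\,\sigma_{k-\nu}\,[(1+\alpha)\nu-\alpha k]\,\nu\qquad(k\ge 2).$$ With $\alpha=2/n$ let $a_k=\sigma_k\gamma_{2/n}^k$ for $k\ge1$. Then for all $x\ge 0$ the series below converges and $$1-\mathcal M_n(x)=\sum_{k=1}^\infty a_k e^{-2kx/n}.$$ If $n\ge 3$, then $a_k>0$ for all $k\ge1$; if $n=2$, then $a_1=1$ and $a_k=0$ for all $k\ge 2$. Consequently there is exactly one positive Borel measure $\mu$ on $[0,\infty)$ with $1-\mathcal M_n(x)=\int_{[0,\infty)}e^{-xt}\,d\mu(t)$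 (a convergent integral) for all $x\ge 0$; it is a probability measure, and it is the atomic measure $\mu=\sum_{k\ge1}a_k\delta_{2k/n}$. In particular $\mu$ is concentrated on $\{2k/n: k=1,2,3,\dots\}$, and $\mu(\{2k/n\})=a_k$ for every $k\ge1$. -/

import Mathlib

open Set MeasureTheory

/-- `F` solves `F' = 1 - F ^ α` on `[0, ∞)` with `F 0 = 0` (one-sided derivative at the
end point). Values of `F` off `[0, ∞)` are irrelevant. Nonnegativity of `F` is not assumed: it
is forced by the equation, since the derivative is `1` at each zero of `F` (for `α ≠ 0`). -/
def IsPowerODESolution (α : ℝ) (F : ℝ → ℝ) : Prop :=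
  F 0 = 0 ∧ ∀ x : ℝ, 0 ≤ x → HasDerivWithinAt F (1 - F x ^ α) (Ici 0) x

/-- `M` is the profile function of index `n`, i.e. solves `M' = 1 - M ^ (2 / n)`, `M 0 = 0`. -/
def IsProfile (n : ℕ) (M : ℝ → ℝ) : Prop :=
  IsPowerODESolution (2 / (n : ℝ)) M

/-- The constant `γ_α = (1 / α) exp (-∫₀¹ (1 - x ^ ((1 - α) / α)) / (1 - x) dx)`. -/
noncomputable def gammaConst (α : ℝ) : ℝ :=
  1 / α * Real.exp (-∫ x in (0 : ℝ)..1, (1 - x ^ ((1 - α) / α)) / (1 - x))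

/-- The coefficients `σ_k`, `k ≥ 1` (with the unused value `0` at `k = 0`); the recurrence is
displayed in `sigmaCoeff_one` and `sigmaCoeff_of_two_le`. -/
noncomputable def sigmaCoeff (α : ℝ) (k : ℕ) : ℝ :=
  if k = 0 then 0
  else if k = 1 then 1
  else 1 / ((k : ℝ) * ((k : ℝ) - 1)) *
    ∑ ν ∈ (Finset.Ico 1 k).attach,
      sigmaCoeff α ν.1 * sigmaCoeff α (k - ν.1) *
        ((1 + α) * (ν.1 : ℝ) - α * (k : ℝ)) * (ν.1 : ℝ)
termination_by k
decreasing_by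
  · have := Finset.mem_Ico.mp ν.2
    omega
  · have := Finset.mem_Ico.mp ν.2
    omega

theorem sigmaCoeff_one (α : ℝ) : sigmaCoeff α 1 = 1 := by
  rw [sigmaCoeff]
  simp

theorem sigmaCoeff_of_two_le (α : ℝ) (k : ℕ) (hk : 2 ≤ k) :
    sigmaCoeff α k = 1 / ((k : ℝ) * ((k : ℝ) - 1)) *
      ∑ ν ∈ Finset.Ico 1 k, sigmaCoeff α ν * sigmaCoeff α (k - ν) *
        ((1 + α) * (ν : ℝ) - α * (k : ℝ)) * (ν : ℝ) := by
  rw [sigmaCoeff, if_neg (by omega), if_neg (by omega)]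
  congr 1
  exact Finset.sum_attach (Finset.Ico 1 k) (fun ν => sigmaCoeff α ν * sigmaCoeff α (k - ν) *
        ((1 + α) * (ν : ℝ) - α * (k : ℝ)) * (ν : ℝ))

/-- `a_k = σ_k γ_α ^ k` with `α = 2 / n`. -/
noncomputable def expCoeff (n k : ℕ) : ℝ :=
  sigmaCoeff (2 / (n : ℝ)) k * gammaConst (2 / (n : ℝ)) ^ k

/-- `μ` is a positive measure on `[0, ∞)` whose Laplace transform is `f` on `[0, ∞)`:
`f x = ∫ e^{-x t} dμ(t)` for every `x ≥ 0`. (At `x = 0` integrability says that `μ` is finite.) -/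
def IsLaplaceMeasure (μ : Measure ℝ) (f : ℝ → ℝ) : Prop :=
  μ (Iio 0) = 0 ∧ ∀ x : ℝ, 0 ≤ x →
    Integrable (fun t : ℝ => Real.exp (-(x * t))) μ ∧
      f x = ∫ t, Real.exp (-(x * t)) ∂μ

/-- The atomic measure `∑_{k ≥ 1} a_k δ_{2k/n}`. -/
noncomputable def atomicMeasure (n : ℕ) : Measure ℝ :=
  Measure.sum fun j : ℕ =>
    ENNReal.ofReal (expCoeff n (j + 1)) • Measure.dirac (2 * ((j : ℝ) + 1) / (n : ℝ))

/-!
Write `s = γ e^{-αx}` and `θ = s d/ds`. A function `F = 1 - S(s)` solves `F' = 1 - F ^ α` exactly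
when `α θS = 1 - (1 - S) ^ α`. Taking the logarithmic derivative of `1 - α θS = (1 - S) ^ α`
eliminates the power and leaves `S θ²S - α (θS)² - θ²S + θS = 0`, whose coefficients are the
recurrence for `σ_k`.

Symmetrizing the quadratic part makes all its weights nonnegative for `α ≤ 1`. Hence `σ_k ≥ 0`, and
every truncation `P` of `S = ∑ σ_k s ^ k` satisfies the equation as an inequality, which integrates
to `α θP ≤ 1 - (1 - P) ^ α` as long as `P < 1`. In terms of the logarithmic linearizing coordinate
`T` of the autonomous equation this says `T(P(s)) ≤ log s`. Since `T(1) = log γ`, a truncation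
cannot reach `1` before `s = γ`. So `S` converges on `[0, γ]`, where it satisfies the equation
itself; now `T(S(s)) = log s` gives `S(γ) = 1`, which is the initial condition. Solutions are unique
because the vector field is antitone on `[0, ∞)`, and the representing measure is unique because
polynomials in `e^{-t}` separate points.
-/

open Filter Topology
open Finset.HasAntidiagonal (antidiagonal mem_antidiagonal)
open scoped NNReal PowerSeries

section EulerOperator

variable {R : Type*} [CommSemiring R]

/-- The Euler operator `θ = X d/dX` on formal power series. Under the substitution `X = e ^ y`
used in `expSeries` it becomes the derivative `d/dy`. -/
noncomputable def eulerOp (p : R⟦X⟧) : R⟦X⟧ :=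
  PowerSeries.X * PowerSeries.derivative R p

theorem coeff_eulerOp (p : R⟦X⟧) (k : ℕ) :
    PowerSeries.coeff k (eulerOp p) = k * PowerSeries.coeff k p := by
  cases k with
  | zero => simp [eulerOp]
  | succ k =>
    rw [eulerOp, PowerSeries.coeff_succ_X_mul, PowerSeries.coeff_derivative, mul_comm]
    push_cast
    rfl

end EulerOperator

section OdeDefect

open PowerSeries (coeff trunc)

variable {α : ℝ} {p : ℝ⟦X⟧}

/-- The defect of `p` in the polynomial differential equation
`p θ²p - α (θp)² - θ²p + θp = 0`, the consequence of `α θp = 1 - (1 - p) ^ α` obtained by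
eliminating the power through a logarithmic derivative. -/
noncomputable def odeDefect (α : ℝ) (p : ℝ⟦X⟧) : ℝ⟦X⟧ :=
  p * eulerOp (eulerOp p) - α • (eulerOp p * eulerOp p) - eulerOp (eulerOp p) + eulerOp p

theorem sum_antidiagonal_eq_sum_add_swap_div_two {K : Type*} [Field K] [CharZero K]
    (f : ℕ × ℕ → K) (k : ℕ) :
    ∑ ij ∈ antidiagonal k, f ij = ∑ ij ∈ antidiagonal k, (f ij + f ij.swap) / 2 := by
  rw [← Finset.sum_div, Finset.sum_add_distrib, Finset.Nat.sum_antidiagonal_swap, add_self_div_two]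

theorem coeff_odeDefect (α : ℝ) (p : ℝ⟦X⟧) (k : ℕ) :
    coeff k (odeDefect α p) =
      ∑ ij ∈ antidiagonal k,
        coeff ij.1 p * coeff ij.2 p * (((ij.1 : ℝ) - ij.2) ^ 2 / 2 + (1 - α) * (ij.1 * ij.2)) -
      k * (k - 1) * coeff k p := by
  have hquad : coeff k (p * eulerOp (eulerOp p)) - α * coeff k (eulerOp p * eulerOp p) =
      ∑ ij ∈ antidiagonal k,
        coeff ij.1 p * coeff ij.2 p * (((ij.1 : ℝ) - ij.2) ^ 2 / 2 + (1 - α) * (ij.1 * ij.2)) := by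
    rw [PowerSeries.coeff_mul, PowerSeries.coeff_mul, Finset.mul_sum, ← Finset.sum_sub_distrib,
      sum_antidiagonal_eq_sum_add_swap_div_two]
    refine Finset.sum_congr rfl fun ij _ => ?_
    simp only [coeff_eulerOp, Prod.fst_swap, Prod.snd_swap]
    ring
  simp only [odeDefect, map_add, map_sub, PowerSeries.coeff_smul, smul_eq_mul, hquad,
    coeff_eulerOp]
  ring

theorem coeff_coe_trunc {R : Type*} [CommSemiring R] (p : R⟦X⟧) (N k : ℕ) :
    coeff k (trunc N p : R⟦X⟧) = if k < N then coeff k p else 0 := by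
  rw [Polynomial.coeff_coe, PowerSeries.coeff_trunc]

theorem coeff_odeDefect_trunc_nonneg (hα : α ≤ 1) (hp : ∀ k, 0 ≤ coeff k p)
    (hE : ∀ k, 0 ≤ coeff k (odeDefect α p)) (N k : ℕ) :
    0 ≤ coeff k (odeDefect α (trunc N p : ℝ⟦X⟧)) := by
  rw [coeff_odeDefect]
  rcases lt_or_ge k N with hk | hk
  · convert hE k using 1
    rw [coeff_odeDefect, coeff_coe_trunc p N k, if_pos hk]
    congr 1
    refine Finset.sum_congr rfl fun ij hij => ?_
    have := mem_antidiagonal.1 hij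
    rw [coeff_coe_trunc, coeff_coe_trunc, if_pos (by omega), if_pos (by omega)]
  · have htrunc (j : ℕ) : 0 ≤ coeff j (trunc N p : ℝ⟦X⟧) := by
      rw [coeff_coe_trunc]
      split_ifs
      exacts [hp j, le_rfl]
    rw [coeff_coe_trunc p N k, if_neg hk.not_gt, mul_zero, sub_zero]
    refine Finset.sum_nonneg fun ij _ => mul_nonneg (mul_nonneg (htrunc _) (htrunc _)) ?_
    have := sub_nonneg.2 hα
    positivity

end OdeDefect

section SigmaCoeff

variable {α : ℝ} {k : ℕ}

theorem sigmaCoeff_zero (α : ℝ) : sigmaCoeff α 0 = 0 := by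
  rw [sigmaCoeff, if_pos rfl]

theorem mul_sub_one_mul_sigmaCoeff (α : ℝ) (k : ℕ) :
    (k : ℝ) * (k - 1) * sigmaCoeff α k =
      ∑ ij ∈ antidiagonal k, sigmaCoeff α ij.1 * sigmaCoeff α ij.2 *
        (((ij.1 : ℝ) - ij.2) ^ 2 / 2 + (1 - α) * (ij.1 * ij.2)) := by
  rcases lt_or_ge k 2 with hk | hk
  · interval_cases k <;> simp [Finset.Nat.antidiagonal_succ, sigmaCoeff_zero]
  have hk2 : (2 : ℝ) ≤ k := mod_cast hk
  have hk0 : (k : ℝ) ≠ 0 := by linarith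
  have hk1 : (k : ℝ) - 1 ≠ 0 := by linarith
  calc (k : ℝ) * (k - 1) * sigmaCoeff α k
      = ∑ ν ∈ Finset.Ico 1 k, sigmaCoeff α ν * sigmaCoeff α (k - ν) *
          ((1 + α) * (ν : ℝ) - α * (k : ℝ)) * (ν : ℝ) := by
        rw [sigmaCoeff_of_two_le α k hk]
        field_simp
    _ = ∑ ν ∈ Finset.range (k + 1), sigmaCoeff α ν * sigmaCoeff α (k - ν) *
          ((1 + α) * (ν : ℝ) - α * (k : ℝ)) * (ν : ℝ) := by
        refine Finset.sum_subset (fun ν hν => ?_) fun ν hν hν' => ?_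
        · simp only [Finset.mem_Ico, Finset.mem_range] at hν ⊢
          omega
        · simp only [Finset.mem_Ico, Finset.mem_range] at hν hν'
          obtain rfl | rfl : ν = 0 ∨ ν = k := by omega
          all_goals simp [sigmaCoeff_zero]
    _ = ∑ ij ∈ antidiagonal k, sigmaCoeff α ij.1 * sigmaCoeff α ij.2 *
          (ij.1 ^ 2 - α * (ij.1 * ij.2)) := by
        rw [Finset.Nat.sum_antidiagonal_eq_sum_range_succ_mk]
        refine Finset.sum_congr rfl fun ν hν => ?_
        rw [Nat.cast_sub (Finset.mem_range_succ_iff.1 hν)]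
        ring
    _ = _ := by
        rw [sum_antidiagonal_eq_sum_add_swap_div_two]
        refine Finset.sum_congr rfl fun ij _ => ?_
        simp only [Prod.fst_swap, Prod.snd_swap]
        ring

theorem sigmaCoeff_pos (hα : α < 1) (hk : 1 ≤ k) : 0 < sigmaCoeff α k := by
  induction k using Nat.strong_induction_on with
  | _ k ih =>
    obtain rfl | hk2 : k = 1 ∨ 2 ≤ k := by omega
    · simp [sigmaCoeff_one]
    have hk2' : (2 : ℝ) ≤ k := mod_cast hk2
    have hweight (i j : ℕ) (hi : 0 < i) (hj : 0 < j) :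
        0 < ((i : ℝ) - j) ^ 2 / 2 + (1 - α) * (i * j) := by
      have := sub_pos.2 hα
      positivity
    have hterm (ij : ℕ × ℕ) (hij : ij ∈ antidiagonal k) (hi : 0 < ij.1) (hj : 0 < ij.2) :
        0 < sigmaCoeff α ij.1 * sigmaCoeff α ij.2 *
          (((ij.1 : ℝ) - ij.2) ^ 2 / 2 + (1 - α) * (ij.1 * ij.2)) := by
      have := mem_antidiagonal.1 hij
      exact mul_pos (mul_pos (ih _ (by omega) hi) (ih _ (by omega) hj)) (hweight _ _ hi hj)
    have hmem : (1, k - 1) ∈ antidiagonal k := mem_antidiagonal.2 (by grind)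
    have hsum : 0 < (k : ℝ) * (k - 1) * sigmaCoeff α k := by
      rw [mul_sub_one_mul_sigmaCoeff]
      refine Finset.sum_pos' (fun ij hij => ?_)
        ⟨_, hmem, hterm _ hmem zero_lt_one (Nat.sub_pos_of_lt hk2)⟩
      rcases Nat.eq_zero_or_pos ij.1 with hi | hi
      · simp [hi, sigmaCoeff_zero]
      rcases Nat.eq_zero_or_pos ij.2 with hj | hj
      · simp [hj, sigmaCoeff_zero]
      exact (hterm ij hij hi hj).le
    exact pos_of_mul_pos_right hsum (mul_nonneg (by linarith) (by linarith))

theorem sigmaCoeff_one_eq_zero (hk : 2 ≤ k) : sigmaCoeff 1 k = 0 := by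
  induction k using Nat.strong_induction_on with
  | _ k ih =>
    rw [sigmaCoeff_of_two_le 1 k hk]
    refine mul_eq_zero_of_right _ (Finset.sum_eq_zero fun ν hν => ?_)
    obtain ⟨hν1, hνk⟩ := Finset.mem_Ico.1 hν
    obtain hν2 | hkν | ⟨rfl, rfl⟩ : 2 ≤ ν ∨ 2 ≤ k - ν ∨ (ν = 1 ∧ k = 2) := by omega
    · simp [ih ν hνk hν2]
    · simp [ih (k - ν) (by omega) hkν]
    · norm_num

theorem sigmaCoeff_nonneg (hα : α ≤ 1) (k : ℕ) : 0 ≤ sigmaCoeff α k := by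
  obtain rfl | hk1 := Nat.eq_zero_or_pos k
  · rw [sigmaCoeff_zero]
  obtain hα | rfl := hα.lt_or_eq
  · exact (sigmaCoeff_pos hα hk1).le
  obtain rfl | hk2 := Nat.eq_or_lt_of_le hk1
  · simp [sigmaCoeff_one]
  · rw [sigmaCoeff_one_eq_zero hk2]

/-- The generating series `∑ σ_k X ^ k`. -/
noncomputable def sigmaSeries (α : ℝ) : ℝ⟦X⟧ :=
  PowerSeries.mk (sigmaCoeff α)

theorem coeff_sigmaSeries (α : ℝ) (k : ℕ) :
    PowerSeries.coeff k (sigmaSeries α) = sigmaCoeff α k :=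
  PowerSeries.coeff_mk k _

theorem odeDefect_sigmaSeries (α : ℝ) : odeDefect α (sigmaSeries α) = 0 := by
  ext k
  simp only [coeff_odeDefect, coeff_sigmaSeries, mul_sub_one_mul_sigmaCoeff, sub_self, map_zero]

end SigmaCoeff

section ExpSeries

open PowerSeries (coeff)

variable {p q : ℝ⟦X⟧} {b y z : ℝ}

/-- The value at `e ^ y` of the power series `p`, as a function of `y`. -/
noncomputable def expSeries (p : ℝ⟦X⟧) (y : ℝ) : ℝ :=
  ∑' k : ℕ, coeff k p * Real.exp (k * y)

/-- The power series `p` converges at `e ^ y` for every `y < b`, so that `expSeries p` is a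
genuine sum on `(-∞, b)`. -/
def IsSummableBelow (p : ℝ⟦X⟧) (b : ℝ) : Prop :=
  ∀ y < b, Summable fun k : ℕ => coeff k p * Real.exp (k * y)

theorem norm_coeff_mul_exp_le (p : ℝ⟦X⟧) (k : ℕ) (hyz : y ≤ z) :
    ‖coeff k p * Real.exp (k * y)‖ ≤ ‖coeff k p * Real.exp (k * z)‖ := by
  simp only [norm_mul, Real.norm_eq_abs, Real.abs_exp]
  gcongr

theorem isSummableBelow_of_summable (h : Summable fun k : ℕ => coeff k p * Real.exp (k * b)) :
    IsSummableBelow p b :=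
  fun _ hy => .of_norm_bounded h.norm fun k => norm_coeff_mul_exp_le p k hy.le

theorem isSummableBelow_coe (P : Polynomial ℝ) (b : ℝ) : IsSummableBelow (P : ℝ⟦X⟧) b :=
  fun _ _ => summable_of_ne_finset_zero (s := P.support) fun k hk => by
    rw [Polynomial.coeff_coe, Polynomial.notMem_support_iff.1 hk, zero_mul]

theorem expSeries_trunc (p : ℝ⟦X⟧) (N : ℕ) (y : ℝ) :
    expSeries (p.trunc N : ℝ⟦X⟧) y = ∑ k ∈ Finset.range N, coeff k p * Real.exp (k * y) := by
  rw [expSeries, tsum_eq_sum (s := Finset.range N) fun k hk => by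
    rw [coeff_coe_trunc, if_neg (Finset.mem_range.not.1 hk), zero_mul]]
  refine Finset.sum_congr rfl fun k hk => ?_
  rw [coeff_coe_trunc, if_pos (Finset.mem_range.1 hk)]

protected theorem IsSummableBelow.eulerOp (hp : IsSummableBelow p b) :
    IsSummableBelow (eulerOp p) b := by
  intro y hy
  obtain ⟨z, hyz, hzb⟩ := exists_between hy
  have hδ : 0 < z - y := sub_pos.2 hyz
  refine .of_norm_bounded ((hp z hzb).norm.mul_left (z - y)⁻¹) fun k => ?_
  have hk : (k : ℝ) * Real.exp (k * y) ≤ (z - y)⁻¹ * Real.exp (k * z) := by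
    have hexp := Real.add_one_le_exp (k * (z - y))
    rw [inv_mul_eq_div, le_div_iff₀ hδ]
    calc (k : ℝ) * Real.exp (k * y) * (z - y) = k * (z - y) * Real.exp (k * y) := by ring
      _ ≤ Real.exp (k * (z - y)) * Real.exp (k * y) := by gcongr; linarith
      _ = Real.exp (k * z) := by rw [← Real.exp_add]; ring_nf
  simp only [coeff_eulerOp, norm_mul, Real.norm_eq_abs, Real.abs_exp, Nat.abs_cast]
  calc (k : ℝ) * |coeff k p| * Real.exp (k * y) = |coeff k p| * (k * Real.exp (k * y)) := by ring
    _ ≤ |coeff k p| * ((z - y)⁻¹ * Real.exp (k * z)) := by gcongr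
    _ = (z - y)⁻¹ * (|coeff k p| * Real.exp (k * z)) := by ring

theorem IsSummableBelow.hasSum (hp : IsSummableBelow p b) (hy : y < b) :
    HasSum (fun k : ℕ => coeff k p * Real.exp (k * y)) (expSeries p y) :=
  (hp y hy).hasSum

theorem IsSummableBelow.hasSum_mul (hp : IsSummableBelow p b) (hq : IsSummableBelow q b)
    (hy : y < b) :
    HasSum (fun k : ℕ => coeff k (p * q) * Real.exp (k * y)) (expSeries p y * expSeries q y) := by
  have hp' := (hp y hy).norm
  have hq' := (hq y hy).norm
  rw [expSeries, expSeries, tsum_mul_tsum_eq_tsum_sum_antidiagonal_of_summable_norm hp' hq']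
  refine (summable_norm_sum_mul_antidiagonal_of_summable_norm hp' hq').of_norm.hasSum.congr_fun
    fun k => ?_
  rw [PowerSeries.coeff_mul, Finset.sum_mul]
  refine Finset.sum_congr rfl fun ij hij => ?_
  rw [← mem_antidiagonal.1 hij, Nat.cast_add, add_mul, Real.exp_add]
  ring

theorem IsSummableBelow.hasSum_odeDefect (hp : IsSummableBelow p b) (α : ℝ) (hy : y < b) :
    HasSum (fun k : ℕ => coeff k (odeDefect α p) * Real.exp (k * y))
      (expSeries p y * expSeries (eulerOp (eulerOp p)) y -
        α * expSeries (eulerOp p) y ^ 2 - expSeries (eulerOp (eulerOp p)) y +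
        expSeries (eulerOp p) y) := by
  have hp₁ := hp.eulerOp
  have hp₂ := hp₁.eulerOp
  rw [sq]
  refine ((((hp.hasSum_mul hp₂ hy).sub ((hp₁.hasSum_mul hp₁ hy).mul_left α)).sub
    (hp₂.hasSum hy)).add (hp₁.hasSum hy)).congr_fun fun k => ?_
  simp only [odeDefect, map_add, map_sub, PowerSeries.coeff_smul, smul_eq_mul]
  ring

theorem IsSummableBelow.hasDerivAt_expSeries (hp : IsSummableBelow p b) (hy : y < b) :
    HasDerivAt (expSeries p) (expSeries (eulerOp p) y) y := by
  obtain ⟨z, hyz, hzb⟩ := exists_between hy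
  refine hasDerivAt_tsum_of_isPreconnected (t := Iio z)
    (g := fun (k : ℕ) y => coeff k p * Real.exp (k * y))
    (g' := fun (k : ℕ) y => coeff k (eulerOp p) * Real.exp (k * y))
    (hp.eulerOp z hzb).norm isOpen_Iio isPreconnected_Iio (fun k w _ => ?_)
    (fun k w hw => norm_coeff_mul_exp_le _ k (le_of_lt hw)) hyz (hp y hy) hyz
  refine (((hasDerivAt_id w).const_mul (k : ℝ)).exp.const_mul (coeff k p)).congr_deriv ?_
  rw [coeff_eulerOp]
  simp only [id]
  ring

theorem continuousOn_expSeries (h : Summable fun k : ℕ => coeff k p * Real.exp (k * b)) :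
    ContinuousOn (expSeries p) (Iic b) :=
  continuousOn_tsum (fun _ => by fun_prop) h.norm fun k _ hy => norm_coeff_mul_exp_le p k hy

theorem IsSummableBelow.tendsto_expSeries_atBot (hp : IsSummableBelow p b) :
    Tendsto (expSeries p) atBot (𝓝 (coeff 0 p)) := by
  obtain ⟨z, hz⟩ := exists_lt b
  rw [← tsum_ite_eq (L := .unconditional ℕ) 0 fun k => coeff k p]
  refine tendsto_tsum_of_dominated_convergence (hp z hz).norm (fun k => ?_) ?_
  · rcases Nat.eq_zero_or_pos k with rfl | hk
    · simp
    · have hexp : Tendsto (fun y : ℝ => Real.exp (k * y)) atBot (𝓝 0) :=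
        Real.tendsto_exp_atBot.comp (tendsto_id.const_mul_atBot (Nat.cast_pos.2 hk))
      simpa [hk.ne'] using hexp.const_mul (coeff k p)
  · filter_upwards [eventually_le_atBot z] with y hy k using norm_coeff_mul_exp_le p k hy

theorem IsSummableBelow.of_X_mul (h : IsSummableBelow (PowerSeries.X * q) b) :
    IsSummableBelow q b := by
  intro y hy
  refine (((summable_nat_add_iff 1).2 (h y hy)).mul_left (Real.exp (-y))).congr fun k => ?_
  rw [PowerSeries.coeff_succ_X_mul, mul_left_comm, ← Real.exp_add]
  push_cast
  ring_nf

theorem IsSummableBelow.exp_neg_mul_expSeries_X_mul (h : IsSummableBelow (PowerSeries.X * q) b)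
    (hy : y < b) : Real.exp (-y) * expSeries (PowerSeries.X * q) y = expSeries q y := by
  rw [expSeries, (h y hy).tsum_eq_zero_add, PowerSeries.coeff_zero_X_mul, zero_mul, zero_add,
    ← tsum_mul_left]
  refine tsum_congr fun k => ?_
  rw [PowerSeries.coeff_succ_X_mul, mul_left_comm, ← Real.exp_add]
  push_cast
  ring_nf

theorem IsSummableBelow.tendsto_exp_neg_mul_expSeries (hp : IsSummableBelow p b)
    (h0 : coeff 0 p = 0) :
    Tendsto (fun y => Real.exp (-y) * expSeries p y) atBot (𝓝 (coeff 1 p)) := by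
  obtain ⟨q, rfl⟩ := PowerSeries.X_dvd_iff.2 (by simpa using h0)
  rw [← zero_add 1, PowerSeries.coeff_succ_X_mul]
  refine hp.of_X_mul.tendsto_expSeries_atBot.congr' ?_
  filter_upwards [eventually_lt_atBot b] with y hy using (hp.exp_neg_mul_expSeries_X_mul hy).symm

theorem expSeries_pos (hp : ∀ k, 0 ≤ coeff k p) (h1 : 0 < coeff 1 p)
    (hy : Summable fun k : ℕ => coeff k p * Real.exp (k * y)) : 0 < expSeries p y :=
  hy.tsum_pos (fun k => mul_nonneg (hp k) (Real.exp_pos _).le) 1 (mul_pos h1 (Real.exp_pos _))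

theorem expSeries_lt_expSeries (hp : ∀ k, 0 ≤ coeff k p) (h1 : 0 < coeff 1 p) (hyz : y < z)
    (hz : Summable fun k : ℕ => coeff k p * Real.exp (k * z)) : expSeries p y < expSeries p z := by
  refine Summable.tsum_lt_tsum (i := 1) (fun k => ?_) ?_ (isSummableBelow_of_summable hz y hyz) hz
  · have := hp k
    gcongr
  · gcongr

end ExpSeries

section Calculus

variable {f f' : ℝ → ℝ} {b l : ℝ}

theorem le_of_hasDerivAt_nonneg_of_tendsto_atBot (hc : ContinuousOn f (Iic b))
    (hf : ∀ y < b, HasDerivAt f (f' y) y) (hf' : ∀ y < b, 0 ≤ f' y)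
    (hl : Tendsto f atBot (𝓝 l)) : l ≤ f b := by
  have hmono : MonotoneOn f (Iic b) := by
    refine monotoneOn_of_hasDerivWithinAt_nonneg (f' := f') (convex_Iic b) hc ?_ ?_ <;>
      rw [interior_Iic]
    exacts [fun y hy => (hf y hy).hasDerivWithinAt, hf']
  refine le_of_tendsto hl ?_
  filter_upwards [eventually_le_atBot b] with y hy using hmono hy self_mem_Iic hy

theorem eq_of_hasDerivAt_zero_of_tendsto_atBot (hc : ContinuousOn f (Iic b))
    (hf : ∀ y < b, HasDerivAt f 0 y) (hl : Tendsto f atBot (𝓝 l)) : l = f b := by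
  refine le_antisymm (le_of_hasDerivAt_nonneg_of_tendsto_atBot hc hf (fun _ _ => le_rfl) hl) ?_
  exact neg_le_neg_iff.1 (le_of_hasDerivAt_nonneg_of_tendsto_atBot (f := -f) hc.neg
    (fun y hy => (hf y hy).neg) (fun _ _ => neg_zero.ge) hl.neg)

end Calculus

section FirstIntegral

variable {α y : ℝ} {A B C : ℝ → ℝ}

theorem hasDerivAt_firstIntegral (hA : HasDerivAt A (B y) y) (hB : HasDerivAt B (C y) y)
    (hlt : A y < 1) :
    HasDerivAt (fun z => (1 - α * B z) * (1 - A z) ^ (-α))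
      (α * (A y * C y - α * B y ^ 2 - C y + B y) * (1 - A y) ^ (-α - 1)) y := by
  have hpos : 0 < 1 - A y := sub_pos.2 hlt
  have hpow : (1 - A y) ^ (-α) = (1 - A y) ^ (-α - 1) * (1 - A y) := by
    rw [← Real.rpow_add_one hpos.ne', sub_add_cancel]
  refine (((hB.const_mul α).const_sub 1).mul
    ((hA.const_sub 1).rpow_const (p := -α) (Or.inl hpos.ne'))).congr_deriv ?_
  rw [hpow]
  ring

theorem tendsto_firstIntegral (hA : Tendsto A atBot (𝓝 0)) (hB : Tendsto B atBot (𝓝 0)) :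
    Tendsto (fun z => (1 - α * B z) * (1 - A z) ^ (-α)) atBot (𝓝 1) := by
  have hA' : Tendsto (fun z => 1 - A z) atBot (𝓝 1) := by simpa using hA.const_sub 1
  simpa using ((hB.const_mul α).const_sub 1).mul (hA'.rpow_const (p := -α) (Or.inl one_ne_zero))

theorem mul_le_one_sub_rpow_of_nonneg (hα : 0 ≤ α) (hA : ∀ z ≤ y, HasDerivAt A (B z) z)
    (hB : ∀ z ≤ y, HasDerivAt B (C z) z) (hlt : ∀ z ≤ y, A z < 1)
    (hA0 : Tendsto A atBot (𝓝 0)) (hB0 : Tendsto B atBot (𝓝 0))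
    (hE : ∀ z ≤ y, 0 ≤ A z * C z - α * B z ^ 2 - C z + B z) :
    α * B y ≤ 1 - (1 - A y) ^ α := by
  have hpos (z : ℝ) (hz : z ≤ y) : 0 < 1 - A z := sub_pos.2 (hlt z hz)
  have hderiv (z : ℝ) (hz : z ≤ y) :=
    hasDerivAt_firstIntegral (α := α) (hA z hz) (hB z hz) (hlt z hz)
  have h := le_of_hasDerivAt_nonneg_of_tendsto_atBot
    (fun z hz => (hderiv z hz).continuousAt.continuousWithinAt)
    (fun z hz => hderiv z hz.le)
    (fun z hz => mul_nonneg (mul_nonneg hα (hE z hz.le)) (Real.rpow_nonneg (hpos z hz.le).le _))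
    (tendsto_firstIntegral hA0 hB0)
  rw [Real.rpow_neg (hpos y le_rfl).le, ← div_eq_mul_inv,
    le_div_iff₀ (Real.rpow_pos_of_pos (hpos y le_rfl) α)] at h
  linarith

theorem mul_eq_one_sub_rpow_of_eq_zero (hA : ∀ z ≤ y, HasDerivAt A (B z) z)
    (hB : ∀ z ≤ y, HasDerivAt B (C z) z) (hlt : ∀ z ≤ y, A z < 1)
    (hA0 : Tendsto A atBot (𝓝 0)) (hB0 : Tendsto B atBot (𝓝 0))
    (hE : ∀ z ≤ y, A z * C z - α * B z ^ 2 - C z + B z = 0) :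
    α * B y = 1 - (1 - A y) ^ α := by
  have hpos : 0 < 1 - A y := sub_pos.2 (hlt y le_rfl)
  have hderiv (z : ℝ) (hz : z ≤ y) : HasDerivAt (fun z => (1 - α * B z) * (1 - A z) ^ (-α)) 0 z :=
    (hasDerivAt_firstIntegral (hA z hz) (hB z hz) (hlt z hz)).congr_deriv (by simp [hE z hz])
  have h := eq_of_hasDerivAt_zero_of_tendsto_atBot
    (fun z hz => (hderiv z hz).continuousAt.continuousWithinAt)
    (fun z hz => hderiv z hz.le) (tendsto_firstIntegral hA0 hB0)
  rw [Real.rpow_neg hpos.le, ← div_eq_mul_inv,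
    eq_div_iff (Real.rpow_pos_of_pos hpos α).ne'] at h
  linarith

end FirstIntegral

section RpowSlope

variable {β w x : ℝ}

/-- The difference quotient of `x ^ β` between `x` and `1`; for `β = (1 - α) / α` it is the
integrand in `gammaConst α`. At `x = 1` it has the value `0` instead of `β`. -/
noncomputable def rpowSlope (β x : ℝ) : ℝ :=
  (1 - x ^ β) / (1 - x)

theorem rpowSlope_mem_Icc (hβ : 0 ≤ β) (hx : x ∈ Icc (0 : ℝ) 1) :
    rpowSlope β x ∈ Icc 0 (max 1 β) := by
  obtain ⟨h0, h1⟩ := hx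
  rcases h1.eq_or_lt with rfl | h1
  · simp [rpowSlope]
  have hx1 : 0 < 1 - x := sub_pos.2 h1
  refine ⟨div_nonneg (sub_nonneg.2 (Real.rpow_le_one h0 h1.le hβ)) hx1.le, ?_⟩
  rw [rpowSlope, div_le_iff₀ hx1]
  rcases le_total 1 β with h | h
  · have hbernoulli := one_add_mul_self_le_rpow_one_add (s := x - 1) (by linarith) h
    rw [add_sub_cancel] at hbernoulli
    rw [max_eq_right h]
    linarith
  · have hpow := Real.rpow_le_rpow_of_exponent_ge' h0 h1.le hβ h
    rw [Real.rpow_one] at hpow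
    rw [max_eq_left h]
    linarith

theorem measurable_rpowSlope (β : ℝ) : Measurable (rpowSlope β) := by
  unfold rpowSlope
  fun_prop

theorem integrableOn_rpowSlope (hβ : 0 ≤ β) : IntegrableOn (rpowSlope β) (Icc 0 1) := by
  refine Measure.integrableOn_of_bounded (M := max 1 β) (by simp)
    (measurable_rpowSlope β).aestronglyMeasurable ?_
  filter_upwards [ae_restrict_mem measurableSet_Icc] with x hx
  obtain ⟨h0, hle⟩ := rpowSlope_mem_Icc hβ hx
  rwa [Real.norm_of_nonneg h0]

theorem continuousOn_integral_rpowSlope (hβ : 0 ≤ β) :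
    ContinuousOn (fun w => ∫ x in w..1, rpowSlope β x) (Icc 0 1) := by
  rw [← uIcc_of_le zero_le_one]
  refine intervalIntegral.continuousOn_primitive_interval_left ?_
  rw [uIcc_of_le zero_le_one]
  exact integrableOn_rpowSlope hβ

theorem hasDerivAt_integral_rpowSlope (hβ : 0 ≤ β) (hw : w ∈ Ioo (0 : ℝ) 1) :
    HasDerivAt (fun w => ∫ x in w..1, rpowSlope β x) (-rpowSlope β w) w := by
  refine intervalIntegral.integral_hasDerivAt_left ?_
    (measurable_rpowSlope β).stronglyMeasurable.stronglyMeasurableAtFilter ?_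
  · rw [intervalIntegrable_iff_integrableOn_Icc_of_le hw.2.le]
    exact (integrableOn_rpowSlope hβ).mono_set (Icc_subset_Icc_left hw.1.le)
  · exact (continuousAt_const.sub (Real.continuousAt_rpow_const _ _ (Or.inl hw.1.ne'))).div
      (by fun_prop) (sub_pos.2 hw.2).ne'

end RpowSlope

section GammaConst

variable {α : ℝ}

theorem gammaConst_pos (hα : 0 < α) : 0 < gammaConst α := by
  unfold gammaConst
  positivity

theorem log_gammaConst (hα : α ≠ 0) :
    Real.log (gammaConst α) =
      Real.log (1 / α) - ∫ x in (0 : ℝ)..1, rpowSlope ((1 - α) / α) x := by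
  rw [gammaConst, Real.log_mul (one_div_ne_zero hα) (Real.exp_ne_zero _), Real.log_exp,
    ← sub_eq_add_neg]
  rfl

end GammaConst

section LogLinearizer

variable {α v b : ℝ} {A B : ℝ → ℝ}

/-- The logarithm of the coordinate linearizing `α v' = 1 - (1 - v) ^ α` at its fixed point `0`:
it grows at unit speed along solutions and is asymptotic to `log v` as `v → 0`. The constant
`gammaConst α` arises as the linearizing coordinate of `v = 1`. -/
noncomputable def logLinearizer (α v : ℝ) : ℝ :=
  Real.log ((1 - (1 - v) ^ α) / α) - ∫ x in (1 - v) ^ α..1, rpowSlope ((1 - α) / α) x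

theorem logLinearizer_one (hα : α ≠ 0) : logLinearizer α 1 = Real.log (gammaConst α) := by
  rw [logLinearizer, log_gammaConst hα, sub_self, Real.zero_rpow hα, sub_zero]

theorem one_sub_one_sub_rpow_pos (hα : 0 < α) (hv : v ∈ Ioc (0 : ℝ) 1) : 0 < 1 - (1 - v) ^ α :=
  sub_pos.2 (Real.rpow_lt_one (by linarith [hv.2]) (by linarith [hv.1]) hα)

theorem hasDerivAt_logLinearizer (hα : α ∈ Ioc (0 : ℝ) 1) (hv : v ∈ Ioo (0 : ℝ) 1) :
    HasDerivAt (logLinearizer α) (α / (1 - (1 - v) ^ α)) v := by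
  have hα0 : α ≠ 0 := hα.1.ne'
  have hβ : 0 ≤ (1 - α) / α := div_nonneg (sub_nonneg.2 hα.2) hα.1.le
  have hv1 : 0 < 1 - v := sub_pos.2 hv.2
  have hw0 : 0 < (1 - v) ^ α := Real.rpow_pos_of_pos hv1 α
  have hw1 : 0 < 1 - (1 - v) ^ α := one_sub_one_sub_rpow_pos hα.1 ⟨hv.1, hv.2.le⟩
  have hw : HasDerivAt (fun v => (1 - v) ^ α) (-1 * α * (1 - v) ^ (α - 1)) v :=
    ((hasDerivAt_id v).const_sub 1).rpow_const (Or.inl hv1.ne')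
  refine ((((hw.const_sub 1).div_const α).log (div_pos hw1 hα.1).ne').sub
    ((hasDerivAt_integral_rpowSlope hβ ⟨hw0, sub_pos.1 hw1⟩).comp v hw)).congr_deriv ?_
  have hpow : ((1 - v) ^ α) ^ ((1 - α) / α) * (1 - v) ^ (α - 1) = 1 := by
    rw [← Real.rpow_mul hv1.le, mul_div_cancel₀ _ hα0, ← Real.rpow_add hv1]
    simp
  rw [rpowSlope]
  field_simp
  linear_combination hpow

theorem continuousOn_logLinearizer (hα : α ∈ Ioc (0 : ℝ) 1) :
    ContinuousOn (logLinearizer α) (Ioc 0 1) := by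
  have hβ : 0 ≤ (1 - α) / α := div_nonneg (sub_nonneg.2 hα.2) hα.1.le
  have hw : ContinuousOn (fun v : ℝ => (1 - v) ^ α) (Ioc 0 1) :=
    (continuousOn_const.sub continuousOn_id).rpow_const fun _ _ => Or.inr hα.1.le
  refine (((continuousOn_const.sub hw).div_const α).log fun v hv =>
    (div_pos (one_sub_one_sub_rpow_pos hα.1 hv) hα.1).ne').sub
      ((continuousOn_integral_rpowSlope hβ).comp hw fun v hv => ?_)
  exact ⟨Real.rpow_nonneg (sub_nonneg.2 hv.2) α,
    (sub_pos.1 (one_sub_one_sub_rpow_pos hα.1 hv)).le⟩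

theorem strictMonoOn_logLinearizer (hα : α ∈ Ioc (0 : ℝ) 1) :
    StrictMonoOn (logLinearizer α) (Ioc 0 1) := by
  refine strictMonoOn_of_deriv_pos (convex_Ioc 0 1) (continuousOn_logLinearizer hα) fun v hv => ?_
  rw [interior_Ioc] at hv
  rw [(hasDerivAt_logLinearizer hα hv).deriv]
  exact div_pos hα.1 (one_sub_one_sub_rpow_pos hα.1 (Ioo_subset_Ioc_self hv))

theorem tendsto_one_sub_one_sub_rpow_div (α : ℝ) :
    Tendsto (fun v : ℝ => (1 - (1 - v) ^ α) / v) (𝓝[≠] 0) (𝓝 α) := by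
  have h : HasDerivAt (fun v : ℝ => 1 - (1 - v) ^ α) α 0 :=
    ((((hasDerivAt_id (0 : ℝ)).const_sub 1).rpow_const (p := α)
      (Or.inl (by simp))).const_sub 1).congr_deriv (by simp)
  refine h.tendsto_slope.congr fun v => ?_
  simp [slope_def_field]

theorem tendsto_logLinearizer_sub_log (hα : α ∈ Ioc (0 : ℝ) 1) :
    Tendsto (fun v => logLinearizer α v - Real.log v) (𝓝[>] 0) (𝓝 0) := by
  have hβ : 0 ≤ (1 - α) / α := div_nonneg (sub_nonneg.2 hα.2) hα.1.le
  have hlog : Tendsto (fun v : ℝ => Real.log ((1 - (1 - v) ^ α) / v / α)) (𝓝[>] 0) (𝓝 0) := by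
    have h := ((tendsto_one_sub_one_sub_rpow_div α).mono_left (nhdsGT_le_nhdsNE 0)).div_const α
    rw [div_self hα.1.ne'] at h
    simpa using h.log one_ne_zero
  have hw : Tendsto (fun v : ℝ => (1 - v) ^ α) (𝓝[>] 0) (𝓝[Icc 0 1] 1) := by
    refine tendsto_nhdsWithin_iff.2 ⟨?_, ?_⟩
    · have : ContinuousAt (fun v : ℝ => (1 - v) ^ α) 0 :=
        (continuousAt_const.sub continuousAt_id).rpow_const (Or.inr hα.1.le)
      simpa using this.tendsto.mono_left nhdsWithin_le_nhds
    · filter_upwards [Ioc_mem_nhdsGT (zero_lt_one' ℝ)] with v hv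
      exact ⟨Real.rpow_nonneg (sub_nonneg.2 hv.2) α,
        (sub_pos.1 (one_sub_one_sub_rpow_pos hα.1 hv)).le⟩
  have hint := (continuousOn_integral_rpowSlope hβ 1 ⟨zero_le_one, le_rfl⟩).tendsto.comp hw
  rw [intervalIntegral.integral_same] at hint
  have h := hlog.sub hint
  rw [sub_zero] at h
  refine h.congr' ?_
  filter_upwards [Ioc_mem_nhdsGT (zero_lt_one' ℝ)] with v hv
  have hw1 := one_sub_one_sub_rpow_pos hα.1 hv
  rw [div_right_comm, Real.log_div (div_pos hw1 hα.1).ne' hv.1.ne']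
  simp only [logLinearizer, Function.comp_apply]
  ring

theorem tendsto_logLinearizer_comp_sub (hα : α ∈ Ioc (0 : ℝ) 1) (hA : ∀ᶠ y in atBot, 0 < A y)
    (hlim : Tendsto (fun y => Real.exp (-y) * A y) atBot (𝓝 1)) :
    Tendsto (fun y => logLinearizer α (A y) - y) atBot (𝓝 0) := by
  have hA0 : Tendsto A atBot (𝓝[>] 0) := by
    refine tendsto_nhdsWithin_iff.2 ⟨?_, hA⟩
    have h := hlim.mul Real.tendsto_exp_atBot
    rw [mul_zero] at h
    refine h.congr fun y => ?_
    rw [mul_right_comm, ← Real.exp_add, neg_add_cancel, Real.exp_zero, one_mul]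
  have h := ((tendsto_logLinearizer_sub_log hα).comp hA0).add (hlim.log one_ne_zero)
  rw [Real.log_one, add_zero] at h
  refine h.congr' ?_
  filter_upwards [hA] with y hy
  rw [Real.log_mul (Real.exp_ne_zero _) hy.ne', Real.log_exp]
  simp only [Function.comp_apply]
  ring

theorem continuousOn_logLinearizer_comp_sub (hα : α ∈ Ioc (0 : ℝ) 1)
    (hc : ContinuousOn A (Iic b)) (hmem : ∀ y < b, A y ∈ Ioo 0 1) (hb : A b ∈ Ioc 0 1) :
    ContinuousOn (fun y => logLinearizer α (A y) - y) (Iic b) := by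
  refine ((continuousOn_logLinearizer hα).comp hc fun y hy => ?_).sub continuousOn_id
  rcases (mem_Iic.1 hy).lt_or_eq with hy | rfl
  exacts [Ioo_subset_Ioc_self (hmem y hy), hb]

theorem hasDerivAt_logLinearizer_comp_sub {y : ℝ} (hα : α ∈ Ioc (0 : ℝ) 1)
    (hA : HasDerivAt A (B y) y) (hmem : A y ∈ Ioo 0 1) :
    HasDerivAt (fun y => logLinearizer α (A y) - y) (α * B y / (1 - (1 - A y) ^ α) - 1) y :=
  (((hasDerivAt_logLinearizer hα hmem).comp y hA).sub (hasDerivAt_id y)).congr_deriv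
    (by rw [div_mul_eq_mul_div])

theorem logLinearizer_le (hα : α ∈ Ioc (0 : ℝ) 1) (hc : ContinuousOn A (Iic b))
    (hA : ∀ y < b, HasDerivAt A (B y) y) (hmem : ∀ y < b, A y ∈ Ioo 0 1) (hb : A b ∈ Ioc 0 1)
    (hlim : Tendsto (fun y => Real.exp (-y) * A y) atBot (𝓝 1))
    (hle : ∀ y < b, α * B y ≤ 1 - (1 - A y) ^ α) : logLinearizer α (A b) ≤ b := by
  have hT := tendsto_logLinearizer_comp_sub hα
    ((eventually_lt_atBot b).mono fun y hy => (hmem y hy).1) hlim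
  have h := le_of_hasDerivAt_nonneg_of_tendsto_atBot
    (f := -fun y => logLinearizer α (A y) - y)
    (continuousOn_logLinearizer_comp_sub hα hc hmem hb).neg
    (fun y hy => (hasDerivAt_logLinearizer_comp_sub hα (hA y hy) (hmem y hy)).neg)
    (fun y hy => ?_) hT.neg
  · rw [neg_zero, Pi.neg_apply, neg_nonneg, sub_nonpos] at h
    exact h
  · have hw := one_sub_one_sub_rpow_pos hα.1 (Ioo_subset_Ioc_self (hmem y hy))
    rw [neg_nonneg, sub_nonpos, div_le_one hw]
    exact hle y hy

theorem logLinearizer_eq (hα : α ∈ Ioc (0 : ℝ) 1) (hc : ContinuousOn A (Iic b))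
    (hA : ∀ y < b, HasDerivAt A (B y) y) (hmem : ∀ y < b, A y ∈ Ioo 0 1) (hb : A b ∈ Ioc 0 1)
    (hlim : Tendsto (fun y => Real.exp (-y) * A y) atBot (𝓝 1))
    (heq : ∀ y < b, α * B y = 1 - (1 - A y) ^ α) : logLinearizer α (A b) = b := by
  have hT := tendsto_logLinearizer_comp_sub hα
    ((eventually_lt_atBot b).mono fun y hy => (hmem y hy).1) hlim
  have h := eq_of_hasDerivAt_zero_of_tendsto_atBot
    (continuousOn_logLinearizer_comp_sub hα hc hmem hb) (fun y hy => ?_) hT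
  · exact sub_eq_zero.1 h.symm
  · have hw := one_sub_one_sub_rpow_pos hα.1 (Ioo_subset_Ioc_self (hmem y hy))
    refine (hasDerivAt_logLinearizer_comp_sub hα (hA y hy) (hmem y hy)).congr_deriv ?_
    rw [heq y hy, div_self hw.ne', sub_self]

end LogLinearizer

section Barrier

open PowerSeries (coeff)

variable {α b y : ℝ} {p : ℝ⟦X⟧}

theorem mul_expSeries_eulerOp_le (hα : 0 ≤ α) (hp : IsSummableBelow p b) (h0 : coeff 0 p = 0)
    (hE : ∀ k, 0 ≤ coeff k (odeDefect α p)) (hy : y < b) (hlt : ∀ z ≤ y, expSeries p z < 1) :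
    α * expSeries (eulerOp p) y ≤ 1 - (1 - expSeries p y) ^ α := by
  have hB0 : coeff 0 (eulerOp p) = 0 := by rw [coeff_eulerOp, Nat.cast_zero, zero_mul]
  exact mul_le_one_sub_rpow_of_nonneg hα
    (fun z hz => hp.hasDerivAt_expSeries (hz.trans_lt hy))
    (fun z hz => hp.eulerOp.hasDerivAt_expSeries (hz.trans_lt hy)) hlt
    (h0 ▸ hp.tendsto_expSeries_atBot) (hB0 ▸ hp.eulerOp.tendsto_expSeries_atBot)
    (fun z hz => (hp.hasSum_odeDefect α (hz.trans_lt hy)).nonneg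
      fun k => mul_nonneg (hE k) (Real.exp_pos _).le)

theorem mul_expSeries_eulerOp_eq (hp : IsSummableBelow p b) (h0 : coeff 0 p = 0)
    (hE : odeDefect α p = 0) (hy : y < b) (hlt : ∀ z ≤ y, expSeries p z < 1) :
    α * expSeries (eulerOp p) y = 1 - (1 - expSeries p y) ^ α := by
  have hB0 : coeff 0 (eulerOp p) = 0 := by rw [coeff_eulerOp, Nat.cast_zero, zero_mul]
  refine mul_eq_one_sub_rpow_of_eq_zero
    (fun z hz => hp.hasDerivAt_expSeries (hz.trans_lt hy))
    (fun z hz => hp.eulerOp.hasDerivAt_expSeries (hz.trans_lt hy)) hlt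
    (h0 ▸ hp.tendsto_expSeries_atBot) (hB0 ▸ hp.eulerOp.tendsto_expSeries_atBot)
    (fun z hz => (hp.hasSum_odeDefect α (hz.trans_lt hy)).unique ?_)
  simp only [hE, map_zero, zero_mul]
  exact hasSum_zero

theorem expSeries_mem_Ioo (hp : ∀ k, 0 ≤ coeff k p) (h1 : 0 < coeff 1 p)
    (hb : Summable fun k : ℕ => coeff k p * Real.exp (k * b)) (hle : expSeries p b ≤ 1)
    (hy : y < b) : expSeries p y ∈ Ioo 0 1 :=
  ⟨expSeries_pos hp h1 (isSummableBelow_of_summable hb y hy),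
    (expSeries_lt_expSeries hp h1 hy hb).trans_le hle⟩

/- If the value exceeded `1`, the series would reach `1` at some `y₁ < log γ`; but
`logLinearizer α` has only grown to at most `y₁` by then, while its value at `1` is `log γ`. -/
theorem expSeries_log_gammaConst_le_one (hα : α ∈ Ioc (0 : ℝ) 1) (hp : ∀ k, 0 ≤ coeff k p)
    (h0 : coeff 0 p = 0) (h1 : coeff 1 p = 1) (hE : ∀ k, 0 ≤ coeff k (odeDefect α p))
    (hb : IsSummableBelow p b) (hγ : Real.log (gammaConst α) < b) :
    expSeries p (Real.log (gammaConst α)) ≤ 1 := by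
  have hc : ContinuousOn (expSeries p) (Iio b) := fun y hy =>
    (hb.hasDerivAt_expSeries hy).continuousAt.continuousWithinAt
  by_contra! hgt
  obtain ⟨y₁, hy₁, hone⟩ : ∃ y₁ < Real.log (gammaConst α), expSeries p y₁ = 1 := by
    obtain ⟨y₀, hy₀, hlt⟩ := ((eventually_lt_atBot (Real.log (gammaConst α))).and
      ((h0 ▸ hb.tendsto_expSeries_atBot).eventually_lt_const zero_lt_one)).exists
    obtain ⟨y₁, ⟨-, hy₁⟩, hone⟩ := intermediate_value_Ioo hy₀.le
      (hc.mono fun z hz => hz.2.trans_lt hγ) ⟨hlt, hgt⟩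
    exact ⟨y₁, hy₁, hone⟩
  have hy₁b : y₁ < b := hy₁.trans hγ
  have hmem (y : ℝ) (hy : y < y₁) : expSeries p y ∈ Ioo 0 1 :=
    expSeries_mem_Ioo hp (h1 ▸ one_pos) (hb y₁ hy₁b) hone.le hy
  have hT := logLinearizer_le hα (hc.mono (Iic_subset_Iio.2 hy₁b))
    (fun y hy => hb.hasDerivAt_expSeries (hy.trans hy₁b)) hmem (by simp [hone])
    (h1 ▸ hb.tendsto_exp_neg_mul_expSeries h0)
    (fun y hy => mul_expSeries_eulerOp_le hα.1.le hb h0 hE (hy.trans hy₁b)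
      fun z hz => (hmem z (hz.trans_lt hy)).2)
  rw [hone, logLinearizer_one hα.1.ne'] at hT
  exact hy₁.not_ge hT

theorem sum_range_coeff_mul_exp_le_one (hα : α ∈ Ioc (0 : ℝ) 1) (hp : ∀ k, 0 ≤ coeff k p)
    (h0 : coeff 0 p = 0) (h1 : coeff 1 p = 1) (hE : ∀ k, 0 ≤ coeff k (odeDefect α p)) (N : ℕ) :
    ∑ k ∈ Finset.range N, coeff k p * Real.exp (k * Real.log (gammaConst α)) ≤ 1 := by
  have hcoeff (k : ℕ) : 0 ≤ coeff k (p.trunc (N + 2) : ℝ⟦X⟧) := by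
    rw [coeff_coe_trunc]
    split_ifs
    exacts [hp k, le_rfl]
  calc ∑ k ∈ Finset.range N, coeff k p * Real.exp (k * Real.log (gammaConst α))
      ≤ ∑ k ∈ Finset.range (N + 2), coeff k p * Real.exp (k * Real.log (gammaConst α)) :=
        Finset.sum_le_sum_of_subset_of_nonneg (Finset.range_mono (by omega))
          fun k _ _ => mul_nonneg (hp k) (Real.exp_pos _).le
    _ = expSeries (p.trunc (N + 2) : ℝ⟦X⟧) (Real.log (gammaConst α)) := (expSeries_trunc p _ _).symm
    _ ≤ 1 := expSeries_log_gammaConst_le_one hα hcoeff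
        (by rw [coeff_coe_trunc, if_pos (by omega), h0])
        (by rw [coeff_coe_trunc, if_pos (by omega), h1])
        (coeff_odeDefect_trunc_nonneg hα.2 hp hE (N + 2)) (isSummableBelow_coe _ _)
        (lt_add_one _)

end Barrier

section SigmaSeries

variable {α y : ℝ}

theorem coeff_sigmaSeries_nonneg (hα : α ≤ 1) (k : ℕ) :
    0 ≤ PowerSeries.coeff k (sigmaSeries α) := by
  rw [coeff_sigmaSeries]
  exact sigmaCoeff_nonneg hα k

theorem coeff_zero_sigmaSeries (α : ℝ) : PowerSeries.coeff 0 (sigmaSeries α) = 0 := by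
  rw [coeff_sigmaSeries, sigmaCoeff_zero]

theorem coeff_one_sigmaSeries (α : ℝ) : PowerSeries.coeff 1 (sigmaSeries α) = 1 := by
  rw [coeff_sigmaSeries, sigmaCoeff_one]

theorem sum_range_sigmaSeries_le_one (hα : α ∈ Ioc (0 : ℝ) 1) (N : ℕ) :
    ∑ k ∈ Finset.range N, PowerSeries.coeff k (sigmaSeries α) *
      Real.exp (k * Real.log (gammaConst α)) ≤ 1 :=
  sum_range_coeff_mul_exp_le_one hα (coeff_sigmaSeries_nonneg hα.2) (coeff_zero_sigmaSeries α)
    (coeff_one_sigmaSeries α) (fun k => by rw [odeDefect_sigmaSeries, map_zero]) N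

theorem summable_sigmaSeries (hα : α ∈ Ioc (0 : ℝ) 1) :
    Summable fun k : ℕ => PowerSeries.coeff k (sigmaSeries α) *
      Real.exp (k * Real.log (gammaConst α)) :=
  summable_of_sum_range_le
    (fun k => mul_nonneg (coeff_sigmaSeries_nonneg hα.2 k) (Real.exp_pos _).le)
    (sum_range_sigmaSeries_le_one hα)

theorem isSummableBelow_sigmaSeries (hα : α ∈ Ioc (0 : ℝ) 1) :
    IsSummableBelow (sigmaSeries α) (Real.log (gammaConst α)) :=
  isSummableBelow_of_summable (summable_sigmaSeries hα)

theorem expSeries_sigmaSeries_le_one (hα : α ∈ Ioc (0 : ℝ) 1) :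
    expSeries (sigmaSeries α) (Real.log (gammaConst α)) ≤ 1 :=
  Real.tsum_le_of_sum_range_le
    (fun k => mul_nonneg (coeff_sigmaSeries_nonneg hα.2 k) (Real.exp_pos _).le)
    (sum_range_sigmaSeries_le_one hα)

theorem expSeries_sigmaSeries_mem_Ioo (hα : α ∈ Ioc (0 : ℝ) 1)
    (hy : y < Real.log (gammaConst α)) : expSeries (sigmaSeries α) y ∈ Ioo 0 1 :=
  expSeries_mem_Ioo (coeff_sigmaSeries_nonneg hα.2) (coeff_one_sigmaSeries α ▸ one_pos)
    (summable_sigmaSeries hα) (expSeries_sigmaSeries_le_one hα) hy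

theorem mul_expSeries_eulerOp_sigmaSeries (hα : α ∈ Ioc (0 : ℝ) 1)
    (hy : y < Real.log (gammaConst α)) :
    α * expSeries (eulerOp (sigmaSeries α)) y = 1 - (1 - expSeries (sigmaSeries α) y) ^ α :=
  mul_expSeries_eulerOp_eq (isSummableBelow_sigmaSeries hα) (coeff_zero_sigmaSeries α)
    (odeDefect_sigmaSeries α) hy
    fun _ hz => (expSeries_sigmaSeries_mem_Ioo hα (hz.trans_lt hy)).2

theorem expSeries_sigmaSeries_log_gammaConst (hα : α ∈ Ioc (0 : ℝ) 1) :
    expSeries (sigmaSeries α) (Real.log (gammaConst α)) = 1 := by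
  have hmem : expSeries (sigmaSeries α) (Real.log (gammaConst α)) ∈ Ioc 0 1 :=
    ⟨expSeries_pos (coeff_sigmaSeries_nonneg hα.2) (coeff_one_sigmaSeries α ▸ one_pos)
      (summable_sigmaSeries hα), expSeries_sigmaSeries_le_one hα⟩
  have hT := logLinearizer_eq hα (continuousOn_expSeries (summable_sigmaSeries hα))
    (fun y hy => (isSummableBelow_sigmaSeries hα).hasDerivAt_expSeries hy)
    (fun y hy => expSeries_sigmaSeries_mem_Ioo hα hy) hmem
    (coeff_one_sigmaSeries α ▸
      (isSummableBelow_sigmaSeries hα).tendsto_exp_neg_mul_expSeries (coeff_zero_sigmaSeries α))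
    (fun y hy => mul_expSeries_eulerOp_sigmaSeries hα hy)
  exact (strictMonoOn_logLinearizer hα).injOn hmem ⟨one_pos, le_rfl⟩
    (hT.trans (logLinearizer_one hα.1.ne').symm)

end SigmaSeries

section Existence

theorem hasDerivWithinAt_Ici_of_continuousOn {E : Type*} [NormedAddCommGroup E] [NormedSpace ℝ E]
    {f f' : ℝ → E} {a x : ℝ} (hf : ContinuousOn f (Ici a)) (hf' : ContinuousOn f' (Ici a))
    (hderiv : ∀ y, a < y → HasDerivAt f (f' y) y) (hx : a ≤ x) :
    HasDerivWithinAt f (f' x) (Ici a) x := by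
  obtain rfl | hx := hx.eq_or_lt
  · refine hasDerivWithinAt_Ici_of_tendsto_deriv (s := Ioi a)
      (fun y hy => (hderiv y hy).differentiableAt.differentiableWithinAt)
      ((hf a self_mem_Ici).mono Ioi_subset_Ici_self) self_mem_nhdsWithin ?_
    refine ((hf' a self_mem_Ici).mono Ioi_subset_Ici_self).tendsto.congr' ?_
    filter_upwards [self_mem_nhdsWithin] with y hy using (hderiv y hy).deriv.symm
  · exact (hderiv x hx).hasDerivWithinAt

theorem isPowerODESolution_one_sub_expSeries {α : ℝ} (hα : α ∈ Ioc (0 : ℝ) 1) :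
    IsPowerODESolution α
      fun x => 1 - expSeries (sigmaSeries α) (Real.log (gammaConst α) - α * x) := by
  have hcont : ContinuousOn
      (fun x => 1 - expSeries (sigmaSeries α) (Real.log (gammaConst α) - α * x)) (Ici 0) :=
    continuousOn_const.sub <| (continuousOn_expSeries (summable_sigmaSeries hα)).comp
      (by fun_prop) fun x hx => sub_le_self _ (mul_nonneg hα.1.le hx)
  refine ⟨?_, fun x hx => hasDerivWithinAt_Ici_of_continuousOn hcont
    (continuousOn_const.sub (hcont.rpow_const fun _ _ => Or.inr hα.1.le)) (fun y hy => ?_) hx⟩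
  · simp [expSeries_sigmaSeries_log_gammaConst hα]
  · have hlt : Real.log (gammaConst α) - α * y < Real.log (gammaConst α) :=
      sub_lt_self _ (mul_pos hα.1 hy)
    refine ((((isSummableBelow_sigmaSeries hα).hasDerivAt_expSeries hlt).comp y
      (((hasDerivAt_id y).const_mul α).const_sub _)).const_sub 1).congr_deriv ?_
    simp only [Pi.sub_apply]
    linear_combination mul_expSeries_eulerOp_sigmaSeries hα hlt

end Existence

section Uniqueness

theorem eqOn_Ici_of_hasDerivWithinAt_of_antitoneOn {v : ℝ → ℝ} {s : Set ℝ} {f g : ℝ → ℝ} {a : ℝ}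
    (hv : AntitoneOn v s)
    (hf : ∀ x ∈ Ici a, HasDerivWithinAt f (v (f x)) (Ici a) x) (hfs : MapsTo f (Ici a) s)
    (hg : ∀ x ∈ Ici a, HasDerivWithinAt g (v (g x)) (Ici a) x) (hgs : MapsTo g (Ici a) s)
    (h : f a = g a) : EqOn f g (Ici a) := by
  have hderiv (x : ℝ) (hx : x ∈ Ici a) : HasDerivWithinAt (fun x => (f x - g x) ^ 2)
      (2 * (f x - g x) * (v (f x) - v (g x))) (Ici a) x :=
    (((hf x hx).sub (hg x hx)).pow 2).congr_deriv (by simp)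
  have hanti : AntitoneOn (fun x => (f x - g x) ^ 2) (Ici a) := by
    refine antitoneOn_of_hasDerivWithinAt_nonpos (convex_Ici a)
      (fun x hx => (hderiv x hx).continuousWithinAt)
      (fun x hx => (hderiv x (interior_subset hx)).mono interior_subset) fun x hx => ?_
    have hfx := hfs (interior_subset hx)
    have hgx := hgs (interior_subset hx)
    rcases le_total (f x) (g x) with hle | hle
    · exact mul_nonpos_of_nonpos_of_nonneg (by linarith) (sub_nonneg.2 (hv hfx hgx hle))
    · exact mul_nonpos_of_nonneg_of_nonpos (by linarith) (sub_nonpos.2 (hv hgx hfx hle))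
  intro x hx
  have hsq : (f x - g x) ^ 2 ≤ 0 := by simpa [h] using hanti self_mem_Ici hx hx
  exact sub_eq_zero.1 (pow_eq_zero_iff two_ne_zero |>.1 (hsq.antisymm (sq_nonneg _)))

variable {α : ℝ} {F G : ℝ → ℝ}

theorem IsPowerODESolution.nonneg (hα : α ≠ 0) (hF : IsPowerODESolution α F) {x : ℝ}
    (hx : 0 ≤ x) : 0 ≤ F x := by
  refine neg_nonpos.1 (image_le_of_deriv_right_lt_deriv_boundary' (a := 0) (b := x)
    (f := fun y => -F y) (f' := fun y => -(1 - F y ^ α)) (B := 0) (B' := 0)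
    (fun y hy => ((hF.2 y hy.1).continuousWithinAt.mono Icc_subset_Ici_self).neg)
    (fun y hy => ((hF.2 y hy.1).mono (Ici_subset_Ici.2 hy.1)).neg)
    (by simp [hF.1]) continuousOn_const (fun y _ => hasDerivWithinAt_const y _ 0)
    (fun y _ hy => ?_) ⟨hx, le_rfl⟩)
  rw [neg_eq_zero.1 hy, Real.zero_rpow hα]
  norm_num

theorem IsPowerODESolution.eqOn (hα : 0 < α) (hF : IsPowerODESolution α F)
    (hG : IsPowerODESolution α G) : EqOn F G (Ici 0) :=
  eqOn_Ici_of_hasDerivWithinAt_of_antitoneOn (v := fun x => 1 - x ^ α) (s := Ici 0)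
    (fun _ hx _ _ hxy => sub_le_sub_left (Real.rpow_le_rpow hx hxy hα.le) 1)
    hF.2 (fun _ hx => hF.nonneg hα.ne' hx) hG.2 (fun _ hx => hG.nonneg hα.ne' hx)
    (hF.1.trans hG.1.symm)

end Uniqueness

section Laplace

/-- The polynomials in `e ^ (-t)`, as an algebra of bounded continuous functions on `[0, ∞)`. A
Laplace transform at the natural numbers determines their integrals. -/
noncomputable def expPolynomials : StarSubalgebra ℝ (BoundedContinuousFunction ℝ≥0 ℝ) where
  carrier := {g | ∃ P : Polynomial ℝ, ∀ t : ℝ≥0, g t = P.eval (Real.exp (-t))}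
  mul_mem' := by
    rintro g h ⟨P, hP⟩ ⟨Q, hQ⟩
    exact ⟨P * Q, fun t => by simp [hP, hQ]⟩
  add_mem' := by
    rintro g h ⟨P, hP⟩ ⟨Q, hQ⟩
    exact ⟨P + Q, fun t => by simp [hP, hQ]⟩
  algebraMap_mem' r := ⟨Polynomial.C r, fun t => by simp⟩
  star_mem' := by
    rintro g ⟨P, hP⟩
    exact ⟨P, fun t => by simp [hP]⟩

theorem separatesPoints_expPolynomials :
    (expPolynomials.map (BoundedContinuousFunction.toContinuousMapStarₐ ℝ)).SeparatesPoints := by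
  intro s t hst
  let e : BoundedContinuousFunction ℝ≥0 ℝ := BoundedContinuousFunction.ofNormedAddCommGroup
    (fun t : ℝ≥0 => Real.exp (-t)) (by fun_prop) 1 (fun t => by simp)
  have he : e ∈ expPolynomials := ⟨Polynomial.X, fun t => by simp [e]⟩
  refine ⟨e, ⟨e.toContinuousMap, ⟨e, he, rfl⟩, rfl⟩, fun h => hst ?_⟩
  exact NNReal.coe_injective (neg_injective (Real.exp_injective h))

variable {μ ν : Measure ℝ} {f : ℝ → ℝ}

theorem IsLaplaceMeasure.isFiniteMeasure (h : IsLaplaceMeasure μ f) : IsFiniteMeasure μ := by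
  simpa [integrable_const_iff] using (h.2 0 le_rfl).1

theorem IsLaplaceMeasure.isProbabilityMeasure (h : IsLaplaceMeasure μ f) (h0 : f 0 = 1) :
    IsProbabilityMeasure μ := by
  rw [isProbabilityMeasure_iff_real]
  simpa [h0] using (h.2 0 le_rfl).2.symm

theorem IsLaplaceMeasure.ae_nonneg (h : IsLaplaceMeasure μ f) : ∀ᵐ t ∂μ, 0 ≤ t := by
  rw [ae_iff]
  simpa [Iio] using h.1

theorem IsLaplaceMeasure.integral_polynomial (h : IsLaplaceMeasure μ f) (P : Polynomial ℝ) :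
    ∫ t, P.eval (Real.exp (-(Real.toNNReal t : ℝ))) ∂μ = P.sum fun k a => a * f k := by
  have hexpand : ∫ t, P.eval (Real.exp (-(Real.toNNReal t : ℝ))) ∂μ =
      ∫ t, ∑ k ∈ P.support, P.coeff k * Real.exp (-(k * t)) ∂μ := by
    refine integral_congr_ae ?_
    filter_upwards [h.ae_nonneg] with t ht
    rw [Real.coe_toNNReal t ht, Polynomial.eval_eq_sum, Polynomial.sum]
    refine Finset.sum_congr rfl fun k _ => ?_
    rw [← Real.exp_nat_mul, mul_neg]
  rw [hexpand, integral_finsetSum _ fun (k : ℕ) _ => (h.2 k k.cast_nonneg).1.const_mul _,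
    Polynomial.sum]
  refine Finset.sum_congr rfl fun k _ => ?_
  rw [integral_const_mul, ← (h.2 k k.cast_nonneg).2]

theorem IsLaplaceMeasure.map_coe_map_toNNReal (h : IsLaplaceMeasure μ f) :
    (μ.map Real.toNNReal).map ((↑) : ℝ≥0 → ℝ) = μ := by
  rw [Measure.map_map (by fun_prop) (by fun_prop)]
  conv_rhs => rw [← Measure.map_id (μ := μ)]
  refine Measure.map_congr ?_
  filter_upwards [h.ae_nonneg] with t ht using Real.coe_toNNReal t ht

theorem IsLaplaceMeasure.unique (hμ : IsLaplaceMeasure μ f) (hν : IsLaplaceMeasure ν f) :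
    μ = ν := by
  have := hμ.isFiniteMeasure
  have := hν.isFiniteMeasure
  rw [← hμ.map_coe_map_toNNReal, ← hν.map_coe_map_toNNReal]
  congr 1
  refine ext_of_forall_mem_subalgebra_integral_eq_of_pseudoEMetric_complete_countable
    separatesPoints_expPolynomials ?_
  rintro g ⟨P, hP⟩
  rw [integral_map (by fun_prop) (by fun_prop), integral_map (by fun_prop) (by fun_prop)]
  simp only [hP]
  rw [hμ.integral_polynomial, hν.integral_polynomial]

end Laplace

section SumDirac

variable {ι : Type*}

theorem sum_smul_dirac_compl_range [Countable ι] {X : Type*} [MeasurableSpace X]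
    [MeasurableSingletonClass X] (w : ι → ENNReal) (t : ι → X) :
    Measure.sum (fun i => w i • Measure.dirac (t i)) (range t)ᶜ = 0 := by
  rw [Measure.sum_apply _ (countable_range t).measurableSet.compl, ENNReal.tsum_eq_zero]
  simp

theorem sum_smul_dirac_singleton {X : Type*} [MeasurableSpace X] [MeasurableSingletonClass X]
    (w : ι → ENNReal) {t : ι → X} (ht : Function.Injective t) (i : ι) :
    Measure.sum (fun i => w i • Measure.dirac (t i)) {t i} = w i := by
  rw [Measure.sum_apply _ (measurableSet_singleton _), tsum_eq_single i fun j hj => ?_]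
  · simp
  · simp [ht.ne hj]

theorem isLaplaceMeasure_sum_smul_dirac [Countable ι] {w t : ι → ℝ} {f : ℝ → ℝ}
    (hw : ∀ i, 0 ≤ w i) (ht : ∀ i, 0 ≤ t i)
    (hf : ∀ x : ℝ, 0 ≤ x → HasSum (fun i => w i * Real.exp (-(x * t i))) (f x)) :
    IsLaplaceMeasure (Measure.sum fun i => ENNReal.ofReal (w i) • Measure.dirac (t i)) f := by
  refine ⟨?_, fun x hx => ?_⟩
  · rw [Measure.sum_apply _ measurableSet_Iio, ENNReal.tsum_eq_zero]
    simp [ht]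
  · have hsum : Summable fun i => (ENNReal.ofReal (w i)).toReal * ‖Real.exp (-(x * t i))‖ := by
      simp only [ENNReal.toReal_ofReal (hw _), Real.norm_eq_abs, Real.abs_exp]
      exact (hf x hx).summable
    refine ⟨integrable_sum_dirac (fun _ => ENNReal.ofReal_ne_top) hsum, ?_⟩
    refine (hf x hx).unique ?_
    simpa only [ENNReal.toReal_ofReal (hw _), smul_eq_mul] using
      hasSum_integral_sum_dirac (f := fun t : ℝ => Real.exp (-(x * t)))
        (fun _ => ENNReal.ofReal_ne_top) hsum

end SumDirac

section LaplaceExpansion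

variable {α : ℝ} {F : ℝ → ℝ} {k : ℕ}

/-- The coefficients `σ_k γ_α ^ k` for an arbitrary exponent `α`; `expCoeff n` is the case
`α = 2 / n`. -/
noncomputable def laplaceCoeff (α : ℝ) (k : ℕ) : ℝ :=
  sigmaCoeff α k * gammaConst α ^ k

/-- The atomic measure `∑_{k ≥ 1} σ_k γ_α ^ k δ_{α k}`; `atomicMeasure n` is the case
`α = 2 / n`. -/
noncomputable def laplaceMeasure (α : ℝ) : Measure ℝ :=
  Measure.sum fun j : ℕ =>
    ENNReal.ofReal (laplaceCoeff α (j + 1)) • Measure.dirac (α * ((j : ℝ) + 1))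

theorem laplaceCoeff_nonneg (hα : α ∈ Ioc (0 : ℝ) 1) (k : ℕ) : 0 ≤ laplaceCoeff α k :=
  mul_nonneg (sigmaCoeff_nonneg hα.2 k) (pow_nonneg (gammaConst_pos hα.1).le k)

theorem laplaceCoeff_pos (hα0 : 0 < α) (hα1 : α < 1) (hk : 1 ≤ k) : 0 < laplaceCoeff α k :=
  mul_pos (sigmaCoeff_pos hα1 hk) (pow_pos (gammaConst_pos hα0) k)

theorem laplaceCoeff_one_one : laplaceCoeff 1 1 = 1 := by
  simp [laplaceCoeff, sigmaCoeff_one, gammaConst]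

theorem laplaceCoeff_one_eq_zero (hk : 2 ≤ k) : laplaceCoeff 1 k = 0 := by
  rw [laplaceCoeff, sigmaCoeff_one_eq_zero hk, zero_mul]

theorem sigmaCoeff_mul_exp (hα : 0 < α) (k : ℕ) (x : ℝ) :
    sigmaCoeff α k * Real.exp (k * (Real.log (gammaConst α) - α * x)) =
      laplaceCoeff α k * Real.exp (-(x * (α * k))) := by
  rw [mul_sub, sub_eq_add_neg, Real.exp_add, Real.exp_nat_mul, Real.exp_log (gammaConst_pos hα),
    laplaceCoeff]
  ring_nf

theorem IsPowerODESolution.hasSum (hα : α ∈ Ioc (0 : ℝ) 1) (hF : IsPowerODESolution α F) {x : ℝ}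
    (hx : 0 ≤ x) :
    HasSum (fun j : ℕ => laplaceCoeff α (j + 1) * Real.exp (-(x * (α * ((j : ℝ) + 1)))))
      (1 - F x) := by
  have hle : Real.log (gammaConst α) - α * x ≤ Real.log (gammaConst α) :=
    sub_le_self _ (mul_nonneg hα.1.le hx)
  have hsum : Summable fun k : ℕ => PowerSeries.coeff k (sigmaSeries α) *
      Real.exp (k * (Real.log (gammaConst α) - α * x)) :=
    .of_norm_bounded (summable_sigmaSeries hα).norm fun k => norm_coeff_mul_exp_le _ k hle
  have h : HasSum (fun k : ℕ => laplaceCoeff α k * Real.exp (-(x * (α * k))))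
      (expSeries (sigmaSeries α) (Real.log (gammaConst α) - α * x)) :=
    hsum.hasSum.congr_fun fun k => by rw [coeff_sigmaSeries, sigmaCoeff_mul_exp hα.1]
  rw [hF.eqOn hα.1 (isPowerODESolution_one_sub_expSeries hα) hx, sub_sub_cancel]
  simpa [laplaceCoeff, sigmaCoeff_zero] using (hasSum_nat_add_iff' 1).2 h

theorem IsPowerODESolution.isLaplaceMeasure (hα : α ∈ Ioc (0 : ℝ) 1)
    (hF : IsPowerODESolution α F) : IsLaplaceMeasure (laplaceMeasure α) fun x => 1 - F x :=
  isLaplaceMeasure_sum_smul_dirac (fun _ => laplaceCoeff_nonneg hα _)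
    (fun j => mul_nonneg hα.1.le j.cast_add_one_pos.le) fun _ hx => hF.hasSum hα hx

theorem laplaceMeasure_compl (α : ℝ) :
    laplaceMeasure α {t : ℝ | ∃ k : ℕ, 1 ≤ k ∧ t = α * (k : ℝ)}ᶜ = 0 := by
  refine measure_mono_null (compl_subset_compl.2 ?_)
    (sum_smul_dirac_compl_range _ fun j : ℕ => α * ((j : ℝ) + 1))
  rintro _ ⟨j, rfl⟩
  exact ⟨j + 1, Nat.le_add_left 1 j, by push_cast; rfl⟩

theorem laplaceMeasure_singleton (hα : α ≠ 0) (hk : 1 ≤ k) :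
    laplaceMeasure α {α * (k : ℝ)} = ENNReal.ofReal (laplaceCoeff α k) := by
  have hinj : Function.Injective fun j : ℕ => α * ((j : ℝ) + 1) :=
    (mul_right_injective₀ hα).comp ((add_left_injective 1).comp Nat.cast_injective)
  obtain ⟨j, rfl⟩ := Nat.exists_eq_add_of_le' hk
  rw [Nat.cast_add_one]
  exact sum_smul_dirac_singleton (fun j => ENNReal.ofReal (laplaceCoeff α (j + 1))) hinj j

end LaplaceExpansion

section TwoDiv

variable {n : ℕ}

theorem two_div_natCast_mem_Ioc (hn : 2 ≤ n) : 2 / (n : ℝ) ∈ Ioc (0 : ℝ) 1 := by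
  have h : (2 : ℝ) ≤ n := mod_cast hn
  exact ⟨by positivity, div_le_one_of_le₀ h (by positivity)⟩

theorem two_div_natCast_lt_one (hn : 3 ≤ n) : 2 / (n : ℝ) < 1 := by
  have h : (3 : ℝ) ≤ n := mod_cast hn
  exact (div_lt_one (by positivity)).2 (by linarith)

theorem atomicMeasure_eq_laplaceMeasure (n : ℕ) :
    atomicMeasure n = laplaceMeasure (2 / (n : ℝ)) := by
  simp only [atomicMeasure, laplaceMeasure, div_mul_eq_mul_div]
  rfl

end TwoDiv

theorem mainTheorem8_general {α : ℝ} (hα : α ∈ Ioc (0 : ℝ) 1) :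
    (∃ F : ℝ → ℝ, IsPowerODESolution α F) ∧
    (α < 1 → ∀ k : ℕ, 1 ≤ k → 0 < laplaceCoeff α k) ∧
    (α = 1 → laplaceCoeff α 1 = 1 ∧ ∀ k : ℕ, 2 ≤ k → laplaceCoeff α k = 0) ∧
    ∀ F : ℝ → ℝ, IsPowerODESolution α F →
      (∀ x : ℝ, 0 ≤ x →
        HasSum (fun j : ℕ => laplaceCoeff α (j + 1) * Real.exp (-(x * (α * ((j : ℝ) + 1)))))
          (1 - F x)) ∧
      (∃ μ : Measure ℝ, IsProbabilityMeasure μ ∧ IsLaplaceMeasure μ (fun x => 1 - F x)) ∧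
      (∀ μ : Measure ℝ, IsLaplaceMeasure μ (fun x => 1 - F x) →
        μ = laplaceMeasure α ∧
        μ {t : ℝ | ∃ k : ℕ, 1 ≤ k ∧ t = α * (k : ℝ)}ᶜ = 0 ∧
        ∀ k : ℕ, 1 ≤ k → μ {α * (k : ℝ)} = ENNReal.ofReal (laplaceCoeff α k)) := by
  refine ⟨⟨_, isPowerODESolution_one_sub_expSeries hα⟩,
    fun hα1 k hk => laplaceCoeff_pos hα.1 hα1 hk, ?_, fun F hF => ?_⟩
  · rintro rfl
    exact ⟨laplaceCoeff_one_one, fun k hk => laplaceCoeff_one_eq_zero hk⟩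
  · have hL := hF.isLaplaceMeasure hα
    refine ⟨fun x hx => hF.hasSum hα hx,
      ⟨_, hL.isProbabilityMeasure (by simp [hF.1]), hL⟩, fun μ hμ => ?_⟩
    obtain rfl := hμ.unique hL
    exact ⟨rfl, laplaceMeasure_compl α, fun k hk => laplaceMeasure_singleton hα.1.ne' hk⟩

theorem mainTheorem8 (n : ℕ) (hn : 2 ≤ n) :
    (∃ M : ℝ → ℝ, IsProfile n M) ∧
    (3 ≤ n → ∀ k : ℕ, 1 ≤ k → 0 < expCoeff n k) ∧
    (n = 2 → expCoeff n 1 = 1 ∧ ∀ k : ℕ, 2 ≤ k → expCoeff n k = 0) ∧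
    ∀ M : ℝ → ℝ, IsProfile n M →
      (∀ x : ℝ, 0 ≤ x →
        HasSum (fun j : ℕ => expCoeff n (j + 1) * Real.exp (-2 * ((j : ℝ) + 1) * x / (n : ℝ)))
          (1 - M x)) ∧
      (∃ μ : Measure ℝ, IsProbabilityMeasure μ ∧ IsLaplaceMeasure μ (fun x => 1 - M x)) ∧
      (∀ μ : Measure ℝ, IsLaplaceMeasure μ (fun x => 1 - M x) →
        μ = atomicMeasure n ∧
        μ {t : ℝ | ∃ k : ℕ, 1 ≤ k ∧ t = 2 / (n : ℝ) * (k : ℝ)}ᶜ = 0 ∧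
        ∀ k : ℕ, 1 ≤ k → μ {2 / (n : ℝ) * (k : ℝ)} = ENNReal.ofReal (expCoeff n k)) := by
  obtain ⟨hexists, hpos, hone, hF⟩ := mainTheorem8_general (two_div_natCast_mem_Ioc hn)
  have hexp (a x : ℝ) : -2 * a * x / (n : ℝ) = -(x * (2 / (n : ℝ) * a)) := by ring
  simp only [hexp, atomicMeasure_eq_laplaceMeasure]
  exact ⟨hexists, fun h3 => hpos (two_div_natCast_lt_one h3), fun h2 => hone (by norm_num [h2]), hF⟩
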